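/- Let $k_1,k_2,k_3\in\mathbb Z_{\ge 0}$, let $L=\mathbb Z[x_1^{\pm1},x_2^{\pm1},x_3^{\pm1}]$, and put \[\mathscr M=\frac{x_1^2+x_2^2+x_3^2+k_1x_2x_3+k_2x_1x_3+k_3x_1x_2}{x_1x_2x_3}\in L .\] Let $\mathcal A(k_1,k_2,k_3)$ be the generalized Markov cluster algebra: the generalized cluster algebra with trivial coefficients and initial cluster $(x_1,x_2,x_3)$ whose initial exchange matrix has $j$-th column equal to $1$ (if $k_j\neq0$) or $2$ (if $k_j=0$) times the $j$-th column of $\begin{bmatrix}0&-1&1\\1&0&-1\\-1&1&0\end{bmatrix}$, and whose exchange polynomials are $Z_j(u)=1+k_ju+u^2$ (if $k_j\ne 0$) or $Z_j(u)=1+u$ (if $k_j=0$). A non-labeled cluster is a triple $(a,b,c)$ obtained by permuting a labeled cluster. The parity $k_y$ of a cluster variable $y$ is $k_i$, where $i$ is the position of $y$ in a labeled cluster. For $y\in L$ write $|y|=y|_{x_1=x_2=x_3=1}$. A $(k_1,k_2,k_3)$-CGC matrix is a matrix $P=(p_{ij})\in SL(2,L)$ such that $p_{12}$ is a cluster variable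 of $\mathcal A(k_1,k_2,k_3)$ and $\mathrm{tr}(P)=\mathscr M p_{12}-k_{p_{12}}$. For $P\in M(2,L)$ put \[S_P=\begin{bmatrix}\mathscr M p_{12}-\mathrm{tr}(P)&0\\(\mathscr M p_{12}-\mathrm{tr}(P))\mathscr M&\mathscr M p_{12}-\mathrm{tr}(P)\end{bmatrix}.\] A $(k_1,k_2,k_3)$-CGC triple associated with $(a,b,c)$ is a triple $(P,Q,R)$ of CGC matrices such that $Q=PR-S_Q$ and $(p_{12},q_{12},r_{12})=(a,b,c)$ is a non-labeled cluster. For $\sigma\in\mathfrak S_3$ and $f\in L$, write $y_i=x_{\sigma(i)}$ and $l_i=k_{\sigma(i)}$, and let \[P_\sigma(f)=\begin{bmatrix}f&y_1\\ *&\frac{-fy_2y_3+l_2y_1y_3+l_3y_1y_2+y_1^2+y_2^2+y_3^2}{y_2y_3}\end{bmatrix},\quad Q_\sigma(f)=\begin{bmatrix}\frac{fy_2+l_1y_2+y_3}{y_1}&y_2\\ *&\frac{-fy_2y_3+l_3y_1y_2+y_1^2+y_2^2}{y_1y_3}\end{bmatrix},\] \[R_\sigma(f)=\begin{bmatrix}\frac{fy_2y_3+l_1y_2y_3+l_2y_1y_3+y_1^2+y_3^2}{y_1y_2}&y_3\\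 *&\frac{-fy_2y_3+y_2^2}{y_1y_2}\end{bmatrix},\] where the $(2,1)$-entries are determined by $\det=1$. The inverse CGC tree $\mathrm{CGC}\mathbb T^\dagger(k_1,k_2,k_3,\sigma,f)$ is the infinite binary tree with root $(P_\sigma(f),Q_\sigma(f),R_\sigma(f))$ in which every vertex $(P,Q,R)$ has the left child $(P,R,P^{-1}(R+S_R))$ and the right child $((P+S_P)R^{-1},P,R)$. (These two operations are the inverses of the operations $(P,Q,R)\mapsto(P,PQ-S_R,Q)$ and $(P,Q,R)\mapsto(Q,QR-S_P,R)$ on CGC triples.) **Theorem.** Let $(P,Q,R)$ be a $(k_1,k_2,k_3)$-CGC triple associated with $(a,b,c)$, and assume that $|b|\le\max\{|a|,|c|\}$. Then there exist a unique $f\in L$, a unique $\sigma\in\mathfrak S_3$ and a unique vertex $v$ of $\mathrm{CGC}\mathbb T^\dagger(k_1,k_2,k_3,\sigma,f)$ such that $v=(P,Q,R)$; that is, there is exactly one triple $(f,\sigma,v)$ with this property. -/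

import Mathlib

namespace GenCohn

noncomputable section

/-! ### Generalized seeds (trivial coefficients) and their mutation -/

/-- The data of a labeled seed of rank `n` over the trivial semifield: the cluster, the exchange
matrix and the exchange polynomials. The coefficient tuple is `(1, …, 1)` and is omitted. -/
structure Seed (n : ℕ) (K : Type*) where
  cluster : Fin n → K
  B : Matrix (Fin n) (Fin n) ℤ
  Z : Fin n → Polynomial ℕ

/-- The degree `d_k` of the `k`-th exchange polynomial. -/
def Seed.deg {n : ℕ} {K : Type*} (s : Seed n K) (k : Fin n) : ℕ := (s.Z k).natDegree

/-- Seed mutation in direction `k`. Since the exchange polynomials have nonzero constant term,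
`Polynomial.reverse` is `Z(u) ↦ u ^ d * Z(u⁻¹)`. -/
def Seed.mutate {n : ℕ} {K : Type*} [Field K] (s : Seed n K) (k : Fin n) : Seed n K where
  cluster := fun j =>
    if j = k then
      (s.cluster k)⁻¹ * (∏ i, s.cluster i ^ (max (-(s.B i k)) 0).toNat) ^ s.deg k *
        Polynomial.aeval (∏ i, s.cluster i ^ (s.B i k)) (s.Z k)
    else s.cluster j
  B := fun i j =>
    if i = k ∨ j = k then -(s.B i j)
    else s.B i j + (s.deg k : ℤ) * (max (s.B i k) 0 * s.B k j + s.B i k * max (-(s.B k j)) 0)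
  Z := fun j => if j = k then (s.Z k).reverse else s.Z j

/-- The seed reached from `s` by mutating successively in the directions listed in `w`. -/
def Seed.mutates {n : ℕ} {K : Type*} [Field K] (s : Seed n K) (w : List (Fin n)) : Seed n K :=
  w.foldl Seed.mutate s

/-! ### Laurent polynomials in three variables -/

/-- The ring `ℤ[x₁^{±1}, x₂^{±1}, x₃^{±1}]`. -/
abbrev Laurent : Type := AddMonoidAlgebra ℤ (Fin 3 → ℤ)

/-- The field `ℚ(x₁, x₂, x₃)`. -/
abbrev RatFun : Type := FractionRing Laurent

/-- The variable `x_i`. -/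
def x (i : Fin 3) : Laurent := AddMonoidAlgebra.single (Pi.single i 1) 1

/-- The inverse variable `x_i⁻¹`. -/
def xinv (i : Fin 3) : Laurent := AddMonoidAlgebra.single (-Pi.single i 1) 1

theorem x_mul_xinv (i : Fin 3) : x i * xinv i = 1 := by
  rw [x, xinv, AddMonoidAlgebra.single_mul_single, add_neg_cancel, one_mul]
  rfl

/-- The value `|a| = a|_{x₁ = x₂ = x₃ = 1}` of a Laurent polynomial. -/
def evalOne : Laurent →ₐ[ℤ] ℤ := AddMonoidAlgebra.lift ℤ ℤ (Fin 3 → ℤ) 1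

theorem evalOne_x (i : Fin 3) : evalOne (x i) = 1 := by
  simp [evalOne, x]

theorem evalOne_xinv (i : Fin 3) : evalOne (xinv i) = 1 := by
  simp [evalOne, xinv]

/-! ### The generalized Markov cluster algebra -/

/-- The sign of the `(i, j)` entry of the initial exchange matrix
`[[0, -, +], [+, 0, -], [-, +, 0]]`. -/
def cyclicSign (i j : Fin 3) : ℤ := if i = j then 0 else if i = j + 1 then 1 else -1

/-- The initial seed of the generalized Markov cluster algebra `𝒜(k₁, k₂, k₃)`: for `k_j = 0` the
`j`-th column of `B` is `2` times the sign pattern and `Z_j = 1 + u`; for `k_j ≠ 0` it is the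
sign pattern itself and `Z_j = 1 + k_j u + u²`. -/
def initialSeed (k : Fin 3 → ℕ) : Seed 3 RatFun where
  cluster := fun i => algebraMap Laurent RatFun (x i)
  B := fun i j => cyclicSign i j * (if k j = 0 then 2 else 1)
  Z := fun j =>
    if k j = 0 then 1 + Polynomial.X
    else 1 + Polynomial.C (k j) * Polynomial.X + Polynomial.X ^ 2

/-- The labeled cluster of `𝒜(k₁, k₂, k₃)` reached by the mutation sequence `w`. -/
def cluster (k : Fin 3 → ℕ) (w : List (Fin 3)) : Fin 3 → RatFun :=
  ((initialSeed k).mutates w).cluster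

/-- `a` is a cluster variable of `𝒜(k₁, k₂, k₃)`. -/
def IsClusterVariable (k : Fin 3 → ℕ) (a : RatFun) : Prop :=
  ∃ (w : List (Fin 3)) (i : Fin 3), cluster k w i = a

/-- `(a, b, c)` is a non-labeled cluster, that is, a permutation of a labeled cluster. -/
def IsNonLabeledCluster (k : Fin 3 → ℕ) (a b c : RatFun) : Prop :=
  ∃ (w : List (Fin 3)) (τ : Equiv.Perm (Fin 3)),
    a = cluster k w (τ 0) ∧ b = cluster k w (τ 1) ∧ c = cluster k w (τ 2)

/-- `m` is the parity `k_a` of `a`: `a` is the `i`-th component of some labeled cluster, and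
`m = k_i`. -/
def HasParity (k : Fin 3 → ℕ) (a : RatFun) (m : ℕ) : Prop :=
  ∃ (w : List (Fin 3)) (i : Fin 3), cluster k w i = a ∧ m = k i

/-- The generalized Markov invariant
`(x₁² + x₂² + x₃² + k₁ x₂ x₃ + k₂ x₁ x₃ + k₃ x₁ x₂) / (x₁ x₂ x₃)`. -/
def markovInv (k : Fin 3 → ℕ) : Laurent :=
  (x 0 ^ 2 + x 1 ^ 2 + x 2 ^ 2 + (k 0 : Laurent) * x 1 * x 2 + (k 1 : Laurent) * x 0 * x 2
    + (k 2 : Laurent) * x 0 * x 1) * (xinv 0 * xinv 1 * xinv 2)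

/-! ### Cluster generalized Cohn matrices and triples -/

/-- `2 × 2` matrices of Laurent polynomials. -/
abbrev Mat : Type := Matrix (Fin 2) (Fin 2) Laurent

/-- `P` is a `(k₁, k₂, k₃)`-cluster generalized Cohn matrix. -/
def IsCGCMatrix (k : Fin 3 → ℕ) (P : Mat) : Prop :=
  P.det = 1 ∧ IsClusterVariable k (algebraMap Laurent RatFun (P 0 1)) ∧
    ∃ m : ℕ, HasParity k (algebraMap Laurent RatFun (P 0 1)) m ∧
      P.trace = markovInv k * P 0 1 - (m : Laurent)

/-- The matrix `S_P`. -/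
def S (k : Fin 3 → ℕ) (P : Mat) : Mat :=
  !![markovInv k * P 0 1 - P.trace, 0;
    (markovInv k * P 0 1 - P.trace) * markovInv k, markovInv k * P 0 1 - P.trace]

/-- `(P, Q, R)` is a `(k₁, k₂, k₃)`-cluster generalized Cohn triple. -/
structure IsCGCTriple (k : Fin 3 → ℕ) (P Q R : Mat) : Prop where
  isCGCMatrix_fst : IsCGCMatrix k P
  isCGCMatrix_snd : IsCGCMatrix k Q
  isCGCMatrix_thd : IsCGCMatrix k R
  mid_eq : Q = P * R - S k Q
  isNonLabeledCluster : IsNonLabeledCluster k (algebraMap Laurent RatFun (P 0 1))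
    (algebraMap Laurent RatFun (Q 0 1)) (algebraMap Laurent RatFun (R 0 1))

/-- `(P, Q, R)` is a `(k₁, k₂, k₃)`-cluster generalized Cohn triple associated with `(a, b, c)`. -/
def IsCGCTripleAssoc (k : Fin 3 → ℕ) (a b c : Laurent) (P Q R : Mat) : Prop :=
  IsCGCTriple k P Q R ∧ P 0 1 = a ∧ Q 0 1 = b ∧ R 0 1 = c

/-! ### The inverse cluster generalized Cohn tree -/

/-- The matrix of determinant one with first row `(t, x_i)` and last entry `v`. -/
def unimodular (i : Fin 3) (t v : Laurent) : Mat := !![t, x i; (t * v - 1) * xinv i, v]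

theorem det_unimodular (i : Fin 3) (t v : Laurent) : (unimodular i t v).det = 1 := by
  rw [unimodular, Matrix.det_fin_two_of]
  linear_combination (1 - t * v) * x_mul_xinv i

/-- The matrix `P_σ(f)`. -/
def rootP (k : Fin 3 → ℕ) (σ : Equiv.Perm (Fin 3)) (f : Laurent) : Mat :=
  unimodular (σ 0) f
    ((-f * x (σ 1) * x (σ 2) + (k (σ 1) : Laurent) * x (σ 0) * x (σ 2)
        + (k (σ 2) : Laurent) * x (σ 0) * x (σ 1) + x (σ 0) ^ 2 + x (σ 1) ^ 2 + x (σ 2) ^ 2)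
      * (xinv (σ 1) * xinv (σ 2)))

/-- The matrix `Q_σ(f)`. -/
def rootQ (k : Fin 3 → ℕ) (σ : Equiv.Perm (Fin 3)) (f : Laurent) : Mat :=
  unimodular (σ 1)
    ((f * x (σ 1) + (k (σ 0) : Laurent) * x (σ 1) + x (σ 2)) * xinv (σ 0))
    ((-f * x (σ 1) * x (σ 2) + (k (σ 2) : Laurent) * x (σ 0) * x (σ 1)
        + x (σ 0) ^ 2 + x (σ 1) ^ 2) * (xinv (σ 0) * xinv (σ 2)))

/-- The matrix `R_σ(f)`. -/
def rootR (k : Fin 3 → ℕ) (σ : Equiv.Perm (Fin 3)) (f : Laurent) : Mat :=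
  unimodular (σ 2)
    ((f * x (σ 1) * x (σ 2) + (k (σ 0) : Laurent) * x (σ 1) * x (σ 2)
        + (k (σ 1) : Laurent) * x (σ 0) * x (σ 2) + x (σ 0) ^ 2 + x (σ 2) ^ 2)
      * (xinv (σ 0) * xinv (σ 1)))
    ((-f * x (σ 1) * x (σ 2) + x (σ 1) ^ 2) * (xinv (σ 0) * xinv (σ 1)))

/-- The left child `(P, R, P⁻¹(R + S_R))`; it inverts `(P, Q, R) ↦ (P, PQ - S_R, Q)`. -/
def leftChild (k : Fin 3 → ℕ) (T : Mat × Mat × Mat) : Mat × Mat × Mat :=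
  (T.1, T.2.2, T.1⁻¹ * (T.2.2 + S k T.2.2))

/-- The right child `((P + S_P)R⁻¹, P, R)`; it inverts `(P, Q, R) ↦ (Q, QR - S_P, R)`. -/
def rightChild (k : Fin 3 → ℕ) (T : Mat × Mat × Mat) : Mat × Mat × Mat :=
  ((T.1 + S k T.1) * T.2.2⁻¹, T.1, T.2.2)

/-- The inverse cluster generalized Cohn tree of `(k, σ, f)`, as the labelling of the vertices of
the infinite full binary tree. A vertex is the list of the turns on the path from the root to it,
last turn first (`false` = left, `true` = right). -/
def invTree (k : Fin 3 → ℕ) (σ : Equiv.Perm (Fin 3)) (f : Laurent) :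
    List Bool → Mat × Mat × Mat
  | [] => (rootP k σ f, rootQ k σ f, rootR k σ f)
  | false :: v => leftChild k (invTree k σ f v)
  | true :: v => rightChild k (invTree k σ f v)

end

end GenCohn

/-! Mutation preserves the exchange matrix up to sign and fixes the palindromic exchange
polynomials. Hence it acts on clusters by Vieta moves: an entry is exchanged for the other root of
the generalized Markov equation, viewed as a quadratic in that entry (`mutates_initialSeed`). All
values at `x = 1` are positive, and a move at an entry that is not the strict maximum creates a new
strict maximum (`IsMarkov.max_lt_vieta`). So every cluster is reached from the initial one by
ascending moves (`ascending_vietas`), and undoing the last of them replaces its largest entry.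

The trace condition involves a parity that could depend on the labeled cluster chosen. Degrees
modulo 2 show that a cluster variable occupies only one position (`position_unique`), so a CGC
triple is an `IsVertex` over its cluster. Cayley–Hamilton then shows that parents and children of
such triples realize the Vieta moves.

Existence is descent. Since the middle entry is not the strict maximum, the largest entry is first
or last, and passing to the right or left parent undoes its move and puts the restored entry in the
middle, so the hypothesis persists. Over the initial cluster the triple is determined by `σ` and
`f`, the upper left entry of its first matrix. For uniqueness, compare the values of the outer
entries: they are equal at a root, the last is larger at a left child, and the first is larger at a
right child. Thus each turn can be read off and undone. -/

namespace GenCohn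

noncomputable section

/-! ### Vieta moves on triples of Laurent polynomials -/

/-- Replacement of `s i` by the other root of the generalized Markov equation. -/
def vieta (k : Fin 3 → ℕ) (i : Fin 3) (s : Fin 3 → Laurent) : Fin 3 → Laurent :=
  Function.update s i (markovInv k * s (i + 1) * s (i + 2) - (k (i + 1) : Laurent) * s (i + 2)
    - (k (i + 2) : Laurent) * s (i + 1) - s i)

/-- Composition of the Vieta moves listed in `w`, applied to the initial cluster. -/
def vietas (k : Fin 3 → ℕ) (w : List (Fin 3)) : Fin 3 → Laurent :=
  w.foldl (fun s i => vieta k i s) x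

theorem vietas_concat (k : Fin 3 → ℕ) (w : List (Fin 3)) (i : Fin 3) :
    vietas k (w ++ [i]) = vieta k i (vietas k w) := by
  simp [vietas]

theorem vieta_of_ne (k : Fin 3 → ℕ) {i j : Fin 3} (h : j ≠ i) (s : Fin 3 → Laurent) :
    vieta k i s j = s j := Function.update_of_ne h _ _

theorem vieta_self (k : Fin 3 → ℕ) (i : Fin 3) (s : Fin 3 → Laurent) :
    vieta k i s i = markovInv k * s (i + 1) * s (i + 2) - (k (i + 1) : Laurent) * s (i + 2)
      - (k (i + 2) : Laurent) * s (i + 1) - s i := Function.update_self _ _ _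

theorem add_one_ne_self (i : Fin 3) : i + 1 ≠ i := by revert i; decide

theorem add_two_ne_self (i : Fin 3) : i + 2 ≠ i := by revert i; decide

theorem eq_or_eq_add_one_or_eq_add_two (i j : Fin 3) : j = i ∨ j = i + 1 ∨ j = i + 2 := by
  revert i j; decide

theorem vieta_vieta (k : Fin 3 → ℕ) (i : Fin 3) (s : Fin 3 → Laurent) :
    vieta k i (vieta k i s) = s := by
  funext j
  by_cases h : j = i
  · subst h
    rw [vieta_self, vieta_of_ne k (add_one_ne_self j), vieta_of_ne k (add_two_ne_self j),
      vieta_self]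
    ring
  · rw [vieta_of_ne k h, vieta_of_ne k h]

/-- A positive solution of the generalized Markov equation. -/
structure IsMarkov (k : Fin 3 → ℕ) (s : Fin 3 → Laurent) : Prop where
  eq : s 0 ^ 2 + s 1 ^ 2 + s 2 ^ 2 + (k 0 : Laurent) * s 1 * s 2 + (k 1 : Laurent) * s 0 * s 2
    + (k 2 : Laurent) * s 0 * s 1 = markovInv k * s 0 * s 1 * s 2
  pos : ∀ i, 0 < evalOne (s i)

/-- Product of the roots of the Markov equation as a monic quadratic in `s i`; this is the exchange
relation of the cluster algebra. -/
theorem IsMarkov.mul_vieta {k : Fin 3 → ℕ} {s : Fin 3 → Laurent} (h : IsMarkov k s) (i : Fin 3) :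
    s i * vieta k i s i
      = s (i + 1) ^ 2 + (k i : Laurent) * s (i + 1) * s (i + 2) + s (i + 2) ^ 2 := by
  rw [vieta_self]
  have e := h.eq
  fin_cases i <;> simp <;> linear_combination -e

theorem isMarkov_x (k : Fin 3 → ℕ) : IsMarkov k x where
  eq := by
    rw [markovInv]
    have h0 := x_mul_xinv 0
    have h1 := x_mul_xinv 1
    have h2 := x_mul_xinv 2
    have h : (x 0 * xinv 0) * (x 1 * xinv 1) * (x 2 * xinv 2) = 1 := by simp [h0, h1, h2]
    linear_combination -(x 0 ^ 2 + x 1 ^ 2 + x 2 ^ 2 + (k 0 : Laurent) * x 1 * x 2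
      + (k 1 : Laurent) * x 0 * x 2 + (k 2 : Laurent) * x 0 * x 1) * h
  pos i := by simp [evalOne_x]

theorem IsMarkov.evalOne_mul_vieta {k : Fin 3 → ℕ} {s : Fin 3 → Laurent} (h : IsMarkov k s)
    (i : Fin 3) : evalOne (s i) * evalOne (vieta k i s i)
      = evalOne (s (i + 1)) ^ 2 + (k i : ℤ) * evalOne (s (i + 1)) * evalOne (s (i + 2))
        + evalOne (s (i + 2)) ^ 2 := by
  simpa using congrArg evalOne (h.mul_vieta i)

theorem IsMarkov.vieta {k : Fin 3 → ℕ} {s : Fin 3 → Laurent} (h : IsMarkov k s) (i : Fin 3) :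
    IsMarkov k (vieta k i s) where
  eq := by
    have e := h.eq
    fin_cases i <;> simp [GenCohn.vieta, Function.update] <;> linear_combination e
  pos j := by
    by_cases hj : j = i
    · subst hj
      have h1 := h.pos (j + 1)
      have h2 := h.pos (j + 2)
      refine pos_of_mul_pos_right (a := evalOne (s j)) ?_ (h.pos j).le
      rw [h.evalOne_mul_vieta]
      positivity
    · rw [vieta_of_ne k hj]
      exact h.pos j

theorem isMarkov_vietas (k : Fin 3 → ℕ) (w : List (Fin 3)) : IsMarkov k (vietas k w) := by
  induction w using List.reverseRecOn with
  | nil => exact isMarkov_x k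
  | append_singleton w i ih => rw [vietas_concat]; exact ih.vieta i

theorem IsMarkov.ne_zero {k : Fin 3 → ℕ} {s : Fin 3 → Laurent} (h : IsMarkov k s) (i : Fin 3) :
    s i ≠ 0 := fun h0 => by simpa [h0] using h.pos i

/-- If the old and new values were both at most the maximum `m` of the other two, their product
would be at most `m ^ 2`; but it is a sum of both squares and a nonnegative term, hence larger. -/
theorem IsMarkov.max_lt_vieta {k : Fin 3 → ℕ} {s : Fin 3 → Laurent} (h : IsMarkov k s) {i : Fin 3}
    (hi : evalOne (s i) ≤ max (evalOne (s (i + 1))) (evalOne (s (i + 2)))) :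
    max (evalOne (s (i + 1))) (evalOne (s (i + 2))) < evalOne (GenCohn.vieta k i s i) := by
  have e := h.evalOne_mul_vieta i
  have h0 := h.pos i
  have h1 := h.pos (i + 1)
  have h2 := h.pos (i + 2)
  have hk : 0 ≤ (k i : ℤ) * evalOne (s (i + 1)) * evalOne (s (i + 2)) := by positivity
  by_contra! hc
  rcases le_total (evalOne (s (i + 1))) (evalOne (s (i + 2))) with hle | hle
  · rw [max_eq_right hle] at hi hc
    nlinarith
  · rw [max_eq_left hle] at hi hc
    nlinarith

/-! ### Labeled clusters and Vieta moves -/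

theorem prod_fin_three_eq {α : Type*} [CommMonoid α] (f : Fin 3 → α) (i : Fin 3) :
    ∏ j, f j = f i * f (i + 1) * f (i + 2) := by
  rw [Fin.prod_univ_three]
  fin_cases i
  · rfl
  · change f 0 * f 1 * f 2 = f 1 * f 2 * f 0
    ac_rfl
  · change f 0 * f 1 * f 2 = f 2 * f 0 * f 1
    ac_rfl

theorem initialSeed_B_self (k : Fin 3 → ℕ) (i : Fin 3) : (initialSeed k).B i i = 0 := by
  simp [initialSeed, cyclicSign]

theorem initialSeed_B_add_one (k : Fin 3 → ℕ) (i : Fin 3) :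
    (initialSeed k).B (i + 1) i = if k i = 0 then 2 else 1 := by
  have : cyclicSign (i + 1) i = 1 := by revert i; decide
  simp [initialSeed, this]

theorem initialSeed_B_add_two (k : Fin 3 → ℕ) (i : Fin 3) :
    (initialSeed k).B (i + 2) i = -if k i = 0 then 2 else 1 := by
  have : cyclicSign (i + 2) i = -1 := by revert i; decide
  simp only [initialSeed, this, neg_one_mul]

theorem initialSeed_natDegree (k : Fin 3 → ℕ) (i : Fin 3) :
    ((initialSeed k).Z i).natDegree = if k i = 0 then 1 else 2 := by
  unfold initialSeed
  dsimp only
  split_ifs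
  · compute_degree!
  · compute_degree!

theorem initialSeed_reverse (k : Fin 3 → ℕ) (i : Fin 3) :
    ((initialSeed k).Z i).reverse = (initialSeed k).Z i := by
  have hd := initialSeed_natDegree k i
  ext n
  rw [Polynomial.coeff_reverse, hd]
  unfold initialSeed
  dsimp only
  split_ifs with h
  · have r0 : Polynomial.revAt 1 0 = 1 := rfl
    have r1 : Polynomial.revAt 1 1 = 0 := rfl
    rcases n with _ | _ | n
    · simp [r0, Polynomial.coeff_one, Polynomial.coeff_X]
    · simp [r1, Polynomial.coeff_one, Polynomial.coeff_X]
    · rw [Polynomial.revAt_eq_self_of_lt (by omega)]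
  · have r0 : Polynomial.revAt 2 0 = 2 := rfl
    have r1 : Polynomial.revAt 2 1 = 1 := rfl
    have r2 : Polynomial.revAt 2 2 = 0 := rfl
    rcases n with _ | _ | _ | n
    · simp [r0, Polynomial.coeff_one, Polynomial.coeff_X, Polynomial.coeff_X_pow]
    · simp [r1]
    · simp [r2, Polynomial.coeff_one, Polynomial.coeff_X, Polynomial.coeff_X_pow]
    · rw [Polynomial.revAt_eq_self_of_lt (by omega)]

/-- In both normalizations (`k = 0` or not) the column factor `c` times the degree `d` is 2. For `p
≠ q` the correction through `i` is therefore minus twice the old entry, which flips its sign; for `p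
= q` it vanishes. -/
theorem cyclicSign_mutate (ε c c' : ℤ) (d : ℕ) (hε : ε = 1 ∨ ε = -1)
    (hc : c = 2 ∧ d = 1 ∨ c = 1 ∧ d = 2) (hc' : 0 ≤ c') {p q i : Fin 3} (hp : p ≠ i)
    (hq : q ≠ i) :
    ε * (cyclicSign p q * c') + (d : ℤ) * (max (ε * (cyclicSign p i * c)) 0
      * (ε * (cyclicSign i q * c')) + ε * (cyclicSign p i * c)
        * max (-(ε * (cyclicSign i q * c'))) 0) = -ε * (cyclicSign p q * c') := by
  have key : (cyclicSign p q = 0 ∧ cyclicSign p i = -cyclicSign i q ∧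
        (cyclicSign i q = 1 ∨ cyclicSign i q = -1)) ∨
      (cyclicSign p i = 1 ∧ cyclicSign i q = 1 ∧ cyclicSign p q = -1) ∨
      (cyclicSign p i = -1 ∧ cyclicSign i q = -1 ∧ cyclicSign p q = 1) := by
    revert p q i; decide
  rcases key with ⟨h1, h2, h3 | h3⟩ | ⟨h1, h2, h3⟩ | ⟨h1, h2, h3⟩ <;>
  rcases hε with rfl | rfl <;> rcases hc with ⟨rfl, rfl⟩ | ⟨rfl, rfl⟩ <;>
  simp [h1, h2, h3, hc'] <;> ring

theorem mutate_B {K : Type*} [Field K] (k : Fin 3 → ℕ) (s : Seed 3 K) (ε : ℤ)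
    (hε : ε = 1 ∨ ε = -1) (hB : s.B = ε • (initialSeed k).B) (hZ : s.Z = (initialSeed k).Z)
    (i : Fin 3) : (s.mutate i).B = (-ε) • (initialSeed k).B := by
  have hd : s.deg i = if k i = 0 then 1 else 2 := by
    rw [Seed.deg, hZ, initialSeed_natDegree]
  funext p q
  simp only [Seed.mutate, hd, hB]
  by_cases hpq : p = i ∨ q = i
  · simp [hpq]
  · rw [if_neg hpq]
    push Not at hpq
    exact cyclicSign_mutate ε _ _ _ hε (by split_ifs <;> simp) (by split_ifs <;> simp) hpq.1 hpq.2

theorem mutate_cluster (k : Fin 3 → ℕ) (s : Seed 3 RatFun) (ε : ℤ) (y : Fin 3 → Laurent)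
    (hε : ε = 1 ∨ ε = -1) (hB : s.B = ε • (initialSeed k).B) (hZ : s.Z = (initialSeed k).Z)
    (hy : IsMarkov k y) (hs : s.cluster = fun j => algebraMap Laurent RatFun (y j)) (i : Fin 3) :
    (s.mutate i).cluster = fun j => algebraMap Laurent RatFun (vieta k i y j) := by
  have hd : s.deg i = if k i = 0 then 1 else 2 := by
    rw [Seed.deg, hZ, initialSeed_natDegree]
  have hne : ∀ j, algebraMap Laurent RatFun (y j) ≠ 0 := fun j => by
    simpa using hy.ne_zero j
  funext j
  by_cases hj : j = i
  · subst hj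
    have e := congrArg (algebraMap Laurent RatFun) (hy.mul_vieta j)
    simp only [map_mul, map_add, map_pow, map_natCast] at e
    simp only [Seed.mutate, if_true, hd, hB, hZ, hs, prod_fin_three_eq _ j, Matrix.smul_apply,
      initialSeed_B_self, initialSeed_B_add_one, initialSeed_B_add_two]
    have n0 := hne j
    have n1 := hne (j + 1)
    have n2 := hne (j + 2)
    -- What remains is that the mutation factor equals the right side of the exchange relation. For
    -- `k j = 0` the entries `±2` in `1 + u` produce the two squares.
    rw [mul_assoc, inv_mul_eq_iff_eq_mul₀ n0, e]
    unfold initialSeed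
    dsimp only
    rcases hε with rfl | rfl <;> split_ifs with hk
    · simp [hk]
      field_simp
      ring
    · simp
      field_simp
      ring
    · simp [hk]
      field_simp
    · simp
      field_simp
  · rw [vieta_of_ne k hj]
    simp [Seed.mutate, hj, hs]

theorem mutates_concat {n : ℕ} {K : Type*} [Field K] (s : Seed n K) (w : List (Fin n)) (i : Fin n) :
    s.mutates (w ++ [i]) = (s.mutates w).mutate i := by
  simp [Seed.mutates]

theorem mutates_initialSeed (k : Fin 3 → ℕ) (w : List (Fin 3)) :
    ((initialSeed k).mutates w).cluster = (fun j => algebraMap Laurent RatFun (vietas k w j)) ∧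
      ((initialSeed k).mutates w).Z = (initialSeed k).Z ∧
      ∃ ε : ℤ, (ε = 1 ∨ ε = -1) ∧ ((initialSeed k).mutates w).B = ε • (initialSeed k).B := by
  induction w using List.reverseRecOn with
  | nil => exact ⟨rfl, rfl, 1, Or.inl rfl, (one_smul _ _).symm⟩
  | append_singleton w i ih =>
    obtain ⟨hc, hZ, ε, hε, hB⟩ := ih
    rw [mutates_concat, vietas_concat]
    refine ⟨mutate_cluster k _ ε _ hε hB hZ (isMarkov_vietas k w) hc i, ?_, -ε, by omega,
      mutate_B k _ ε hε hB hZ i⟩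
    funext j
    simp only [Seed.mutate, hZ]
    split_ifs with h
    · rw [← h, initialSeed_reverse]
    · rfl

theorem cluster_eq (k : Fin 3 → ℕ) (w : List (Fin 3)) (i : Fin 3) :
    cluster k w i = algebraMap Laurent RatFun (vietas k w i) :=
  congrFun (mutates_initialSeed k w).1 i

theorem algebraMap_inj {a b : Laurent} :
    algebraMap Laurent RatFun a = algebraMap Laurent RatFun b ↔ a = b :=
  (IsFractionRing.injective Laurent RatFun).eq_iff

/-! ### Degrees of cluster variables modulo two -/

open Filter Asymptotics

/-- Evaluation of a Laurent polynomial at a point with real nonzero coordinates. -/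
def evalReal (u : Fin 3 → ℝˣ) : Laurent →ₐ[ℤ] ℝ :=
  AddMonoidAlgebra.lift ℤ ℝ (Fin 3 → ℤ)
    { toFun := fun e => ((∏ i, u i ^ (e.toAdd i) : ℝˣ) : ℝ)
      map_one' := by simp
      map_mul' := fun a b => by
        simp [zpow_add₀, Finset.prod_mul_distrib] }

theorem evalReal_x (u : Fin 3 → ℝˣ) (i : Fin 3) : evalReal u (x i) = u i := by
  simp only [evalReal, x, AddMonoidAlgebra.lift_single]
  simp [Pi.single_apply]

/-- The point whose `p`-th coordinate is `exp t` and whose other coordinates are `1`. -/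
def axisPoint (p : Fin 3) (t : ℝ) : Fin 3 → ℝˣ :=
  fun i => if i = p then Units.mk0 (Real.exp t) (Real.exp_ne_zero t) else 1

/-- The restriction of a Laurent polynomial to the `p`-th coordinate axis, in logarithmic scale. -/
def axis (p : Fin 3) (a : Laurent) (t : ℝ) : ℝ := evalReal (axisPoint p t) a

/-- All terms are positive, so nothing cancels and the dominant square gives the order of growth. -/
theorem isTheta_axis {f g h : ℝ → ℝ} {d e : ℤ} {κ : ℝ} (hκ : 0 ≤ κ) (hf : ∀ t, 0 < f t)
    (hg : ∀ t, 0 < g t) (hde : d ≤ e)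
    (hfd : f =Θ[atTop] fun t => Real.exp t ^ d) (hge : g =Θ[atTop] fun t => Real.exp t ^ e)
    (hh : ∀ t, h t = f t ^ 2 + κ * f t * g t + g t ^ 2) :
    h =Θ[atTop] fun t => Real.exp t ^ (2 * e) := by
  have hsq : (fun t => Real.exp t ^ (2 * e)) = fun t : ℝ => (Real.exp t ^ e) ^ 2 := by
    funext t
    rw [mul_comm, zpow_mul]
    norm_cast
  have hle : f =O[atTop] fun t => Real.exp t ^ e := by
    refine hfd.1.trans (IsBigO.of_bound 1 ?_)
    filter_upwards [eventually_ge_atTop 0] with t ht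
    rw [one_mul, Real.norm_of_nonneg (by positivity), Real.norm_of_nonneg (by positivity)]
    exact zpow_le_zpow_right₀ (Real.one_le_exp ht) hde
  rw [hsq]
  constructor
  · have h1 := hle.pow 2
    have h2 := hge.1.pow 2
    have h3 := ((hle.mul hge.1).const_mul_left κ)
    have h3' : (fun t => κ * (f t * g t)) =O[atTop] fun t => (Real.exp t ^ e) ^ 2 := by
      simpa only [sq] using h3
    refine ((h1.add h3').add h2).congr_left fun t => ?_
    rw [hh]
    ring
  · refine (hge.2.pow 2).trans (IsBigO.of_bound 1 (Eventually.of_forall fun t => ?_))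
    have h1 := hf t
    have h2 := hg t
    have h3 : 0 ≤ κ * f t * g t := by positivity
    rw [one_mul, hh, Real.norm_of_nonneg (by positivity), Real.norm_of_nonneg (by positivity)]
    nlinarith

/-- A Vieta move replaces the exponent `d` by `2 * m - d`, where `m` is the larger exponent of the
other two entries, so its parity never changes. Initially it is odd exactly at position `p`. -/
theorem exists_isTheta_axis (k : Fin 3 → ℕ) (p : Fin 3) (w : List (Fin 3)) (i : Fin 3) :
    (∀ t, 0 < axis p (vietas k w i) t) ∧
      ∃ d : ℤ, (axis p (vietas k w i) =Θ[atTop] fun t => Real.exp t ^ d) ∧ (Odd d ↔ i = p) := by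
  induction w using List.reverseRecOn generalizing i with
  | nil =>
    have hx : ∀ t, axis p (x i) t = if i = p then Real.exp t else 1 := fun t => by
      simp only [axis, evalReal_x, axisPoint]
      split_ifs <;> rfl
    refine ⟨fun t => ?_, if i = p then 1 else 0, ?_, ?_⟩
    · change 0 < axis p (x i) t
      rw [hx]
      split_ifs <;> positivity
    · change axis p (x i) =Θ[atTop] _
      rw [funext hx]
      split_ifs <;> simp [isTheta_refl]
    · split_ifs with h <;> simp [h]
  | append_singleton w j ih =>
    rw [vietas_concat]
    by_cases hij : i = j
    · subst hij
      have e : ∀ t, axis p (vietas k w i) t * axis p (vieta k i (vietas k w) i) t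
          = axis p (vietas k w (i + 1)) t ^ 2
            + (k i : ℝ) * axis p (vietas k w (i + 1)) t * axis p (vietas k w (i + 2)) t
            + axis p (vietas k w (i + 2)) t ^ 2 := fun t => by
        simpa [axis] using congrArg (evalReal (axisPoint p t)) ((isMarkov_vietas k w).mul_vieta i)
      obtain ⟨h0, d, hd, hodd⟩ := ih i
      obtain ⟨h1, d₁, hd₁, -⟩ := ih (i + 1)
      obtain ⟨h2, d₂, hd₂, -⟩ := ih (i + 2)
      refine ⟨fun t => ?_, ?_⟩
      · refine pos_of_mul_pos_right (a := axis p (vietas k w i) t) ?_ (h0 t).le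
        rw [e]
        have := h1 t
        have := h2 t
        positivity
      · have key : ∃ m : ℤ, (fun t => axis p (vietas k w i) t
            * axis p (vieta k i (vietas k w) i) t) =Θ[atTop] fun t => Real.exp t ^ (2 * m) := by
          rcases le_total d₁ d₂ with hle | hle
          · exact ⟨d₂, isTheta_axis (Nat.cast_nonneg (k i)) h1 h2 hle hd₁ hd₂ e⟩
          · refine ⟨d₁, isTheta_axis (Nat.cast_nonneg (k i)) h2 h1 hle hd₂ hd₁ fun t => ?_⟩
            rw [e]
            ring
        obtain ⟨m, hm⟩ := key
        refine ⟨2 * m - d, ?_, ?_⟩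
        · have hdiv := hm.div hd
          have e1 : ∀ t, axis p (vietas k w i) t * axis p (vieta k i (vietas k w) i) t
              / axis p (vietas k w i) t = axis p (vieta k i (vietas k w) i) t := fun t =>
            mul_div_cancel_left₀ _ (h0 t).ne'
          have e2 : ∀ t, Real.exp t ^ (2 * m) / Real.exp t ^ d = Real.exp t ^ (2 * m - d) :=
            fun t => (zpow_sub₀ (Real.exp_ne_zero t) _ _).symm
          exact ⟨hdiv.1.congr e1 e2, hdiv.2.congr e2 e1⟩
        · rw [← hodd, Int.odd_iff, Int.odd_iff]
          omega
    · rw [vieta_of_ne k hij]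
      exact ih i

theorem eq_of_isTheta_exp_zpow {d e : ℤ}
    (h : (fun t : ℝ => Real.exp t ^ d) =Θ[atTop] fun t => Real.exp t ^ e) : d = e := by
  have key : ∀ {d e : ℤ}, ((fun t : ℝ => Real.exp t ^ d) =O[atTop] fun t => Real.exp t ^ e) →
      d ≤ e := by
    intro d e h
    simp only [← Real.rpow_intCast, ← Real.exp_mul] at h
    by_contra! hlt
    -- The estimate now says that `(d - e) * t` is bounded above for large `t`.
    rw [Real.isBigO_exp_comp_exp_comp] at h
    obtain ⟨c, hc⟩ := h
    rw [eventually_map] at hc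
    obtain ⟨t, ht, ht1⟩ := (hc.and (eventually_gt_atTop (max c 0))).exists
    have h1 : (1 : ℝ) ≤ d - e := by exact_mod_cast (by omega : 1 ≤ d - e)
    have h2 := (le_max_left c 0).trans_lt ht1
    have h3 := (le_max_right c 0).trans_lt ht1
    simp only [Pi.sub_apply] at ht
    nlinarith
  exact le_antisymm (key h.1) (key h.2)

/-- A cluster variable occurs at one position only. -/
theorem position_unique (k : Fin 3 → ℕ) {w w' : List (Fin 3)} {i j : Fin 3}
    (h : vietas k w i = vietas k w' j) : i = j := by
  obtain ⟨-, d, hd, hodd⟩ := exists_isTheta_axis k j w i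
  obtain ⟨-, e, he, hodd'⟩ := exists_isTheta_axis k j w' j
  rw [h] at hd
  have := eq_of_isTheta_exp_zpow (hd.symm.trans he)
  subst this
  exact hodd.1 (hodd'.2 rfl)

/-! ### Parities and triples of matrices -/

theorem perm_three_cases (τ : Equiv.Perm (Fin 3)) (i j l : Fin 3) (hij : i ≠ j) (hil : i ≠ l)
    (hjl : j ≠ l) :
    (τ j = τ i + 1 ∧ τ l = τ i + 2) ∨ (τ j = τ i + 2 ∧ τ l = τ i + 1) := by
  revert τ i j l; decide

theorem vieta_perm (k : Fin 3 → ℕ) (s : Fin 3 → Laurent) (τ : Equiv.Perm (Fin 3)) {i j l : Fin 3}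
    (hij : i ≠ j) (hil : i ≠ l) (hjl : j ≠ l) :
    vieta k (τ i) s (τ i) = markovInv k * s (τ j) * s (τ l) - (k (τ j) : Laurent) * s (τ l)
      - (k (τ l) : Laurent) * s (τ j) - s (τ i) := by
  rw [vieta_self]
  rcases perm_three_cases τ i j l hij hil hjl with ⟨h1, h2⟩ | ⟨h1, h2⟩ <;> rw [h1, h2]
  ring

/-- `(P, Q, R)` is a triple of unimodular matrices with upper right entries
`(s (τ 0), s (τ 1), s (τ 2))` that satisfies the defining relations of a CGC triple. -/
structure IsVertex (k : Fin 3 → ℕ) (s : Fin 3 → Laurent) (τ : Equiv.Perm (Fin 3))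
    (T : Mat × Mat × Mat) : Prop where
  det_fst : T.1.det = 1
  det_snd : T.2.1.det = 1
  det_thd : T.2.2.det = 1
  fst : T.1 0 1 = s (τ 0)
  snd : T.2.1 0 1 = s (τ 1)
  thd : T.2.2 0 1 = s (τ 2)
  trace_fst : T.1.trace = markovInv k * s (τ 0) - (k (τ 0) : Laurent)
  trace_snd : T.2.1.trace = markovInv k * s (τ 1) - (k (τ 1) : Laurent)
  trace_thd : T.2.2.trace = markovInv k * s (τ 2) - (k (τ 2) : Laurent)
  mid_eq : T.2.1 = T.1 * T.2.2 - S k T.2.1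

/-- The parent `(P, PQ - S_R, Q)` of a left child `(P, Q, R)`. -/
def leftParent (k : Fin 3 → ℕ) (T : Mat × Mat × Mat) : Mat × Mat × Mat :=
  (T.1, T.1 * T.2.1 - S k T.2.2, T.2.1)

/-- The parent `(Q, QR - S_P, R)` of a right child `(P, Q, R)`. -/
def rightParent (k : Fin 3 → ℕ) (T : Mat × Mat × Mat) : Mat × Mat × Mat :=
  (T.2.1, T.2.1 * T.2.2 - S k T.1, T.2.2)

/-! ### Trace identities for two-by-two matrices -/

section Entries

variable {A : Type*} [CommRing A] {M m₁ m₂ m₃ : A} {P Q R : Matrix (Fin 2) (Fin 2) A}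

/-- The matrix `m (1 + M E₂₁)`. -/
def lowerMat (M m : A) : Matrix (Fin 2) (Fin 2) A := !![m, 0; m * M, m]

theorem mul_apply_zero_one (P Q : Matrix (Fin 2) (Fin 2) A) :
    (P * Q) 0 1 = P 0 0 * Q 0 1 + P 0 1 * Q 1 1 := by
  simp [Matrix.mul_apply, Fin.sum_univ_two]

theorem trace_mul_two (P Q : Matrix (Fin 2) (Fin 2) A) :
    (P * Q).trace = P 0 0 * Q 0 0 + P 0 1 * Q 1 0 + (P 1 0 * Q 0 1 + P 1 1 * Q 1 1) := by
  simp [Matrix.mul_apply, Fin.sum_univ_two, Matrix.trace_fin_two]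

theorem sub_lowerMat_zero_one (M m : A) (P : Matrix (Fin 2) (Fin 2) A) :
    (P - lowerMat M m) 0 1 = P 0 1 := by
  simp [lowerMat]

theorem trace_sub_lowerMat (M m : A) (P : Matrix (Fin 2) (Fin 2) A) :
    (P - lowerMat M m).trace = P.trace - 2 * m := by
  simp [lowerMat, Matrix.trace_fin_two]
  ring

/-- The determinant changes by `m * (m + M * P 0 1 - P.trace)`, which the trace condition kills. -/
theorem det_sub_lowerMat (M m : A) {P : Matrix (Fin 2) (Fin 2) A} (hP : P.det = 1)
    (ht : P.trace = M * P 0 1 + m) : (P - lowerMat M m).det = 1 := by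
  rw [Matrix.det_fin_two] at hP ⊢
  rw [Matrix.trace_fin_two] at ht
  simp [lowerMat]
  linear_combination hP - m * ht

theorem det_add_lowerMat (M m : A) {P : Matrix (Fin 2) (Fin 2) A} (hP : P.det = 1)
    (ht : P.trace = M * P 0 1 - m) : (P + lowerMat M m).det = 1 := by
  rw [Matrix.det_fin_two] at hP ⊢
  rw [Matrix.trace_fin_two] at ht
  simp [lowerMat]
  linear_combination hP + m * ht

theorem mid_zero_one (hQ : Q = P * R - lowerMat M m₂) :
    Q 0 1 = P 0 0 * R 0 1 + P 0 1 * R 1 1 := by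
  rw [hQ, sub_lowerMat_zero_one, mul_apply_zero_one]

theorem mid_entries (hQ : Q = P * R - lowerMat M m₂) :
    Q 0 0 = P 0 0 * R 0 0 + P 0 1 * R 1 0 - m₂ ∧ Q 0 1 = P 0 0 * R 0 1 + P 0 1 * R 1 1 ∧
    Q 1 0 = P 1 0 * R 0 0 + P 1 1 * R 1 0 - m₂ * M ∧
    Q 1 1 = P 1 0 * R 0 1 + P 1 1 * R 1 1 - m₂ := by
  subst hQ
  simp [lowerMat, Matrix.mul_apply, Fin.sum_univ_two]

/-- By Cayley–Hamilton, `P * Q` is `P.trace • (P * R) - R - P * lowerMat M m₂`; its upper right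
entry is the Vieta conjugate of `R 0 1`. -/
theorem leftParent_zero_one (hP : P.det = 1) (tP : P.trace = M * P 0 1 - m₁)
    (hQ : Q = P * R - lowerMat M m₂) :
    (P * Q) 0 1 = M * P 0 1 * Q 0 1 - m₁ * Q 0 1 - m₂ * P 0 1 - R 0 1 := by
  obtain ⟨h00, h01, h10, h11⟩ := mid_entries hQ
  rw [Matrix.det_fin_two] at hP
  rw [Matrix.trace_fin_two] at tP
  rw [mul_apply_zero_one, h01, h11]
  linear_combination (P 0 0 * R 0 1 + P 0 1 * R 1 1) * tP - R 0 1 * hP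

/-- The sign of `m₃` is opposite to that in the CGC condition; subtracting `lowerMat M m₃` lowers
the trace by `2 * m₃` and corrects it. -/
theorem leftParent_trace (hP : P.det = 1) (tP : P.trace = M * P 0 1 - m₁)
    (tQ : Q.trace = M * Q 0 1 - m₂) (tR : R.trace = M * R 0 1 - m₃)
    (hQ : Q = P * R - lowerMat M m₂) : (P * Q).trace = M * (P * Q) 0 1 + m₃ := by
  rw [leftParent_zero_one hP tP hQ]
  obtain ⟨h00, h01, h10, h11⟩ := mid_entries hQ
  rw [Matrix.det_fin_two] at hP
  rw [Matrix.trace_fin_two] at tP tQ tR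
  have h : (P * Q).trace = (P 0 0 + P 1 1) * (Q 0 0 + Q 1 1 + m₂) - (R 0 0 + R 1 1)
      - m₂ * M * P 0 1 := by
    rw [trace_mul_two, h00, h01, h10, h11]
    linear_combination -(R 0 0 + R 1 1) * hP
  rw [h, tP, tQ, tR]
  ring

theorem rightParent_zero_one (hR : R.det = 1) (tR : R.trace = M * R 0 1 - m₃)
    (hQ : Q = P * R - lowerMat M m₂) :
    (Q * R) 0 1 = M * Q 0 1 * R 0 1 - m₂ * R 0 1 - m₃ * Q 0 1 - P 0 1 := by
  obtain ⟨h00, h01, h10, h11⟩ := mid_entries hQ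
  rw [Matrix.det_fin_two] at hR
  rw [Matrix.trace_fin_two] at tR
  rw [mul_apply_zero_one, h00, h01]
  linear_combination (P 0 0 * R 0 1 + P 0 1 * R 1 1) * tR - P 0 1 * hR

theorem rightParent_trace (hR : R.det = 1) (tP : P.trace = M * P 0 1 - m₁)
    (tQ : Q.trace = M * Q 0 1 - m₂) (tR : R.trace = M * R 0 1 - m₃)
    (hQ : Q = P * R - lowerMat M m₂) : (Q * R).trace = M * (Q * R) 0 1 + m₁ := by
  rw [rightParent_zero_one hR tR hQ]
  obtain ⟨h00, h01, h10, h11⟩ := mid_entries hQ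
  rw [Matrix.det_fin_two] at hR
  rw [Matrix.trace_fin_two] at tP tQ tR
  have h : (Q * R).trace = (R 0 0 + R 1 1) * (Q 0 0 + Q 1 1 + m₂) - (P 0 0 + P 1 1)
      - m₂ * M * R 0 1 := by
    rw [trace_mul_two, h00, h01, h10, h11]
    linear_combination -(P 0 0 + P 1 1) * hR
  rw [h, tP, tQ, tR]
  ring

theorem inv_eq_of_det_eq_one (hP : P.det = 1) : P⁻¹ = !![P 1 1, -P 0 1; -P 1 0, P 0 0] := by
  rw [Matrix.inv_def, hP, Ring.inverse_one, one_smul, Matrix.adjugate_fin_two]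

theorem leftChild_zero_one (hP : P.det = 1) (tP : P.trace = M * P 0 1 - m₁)
    (hQ : Q = P * R - lowerMat M m₂) :
    (P⁻¹ * (R + lowerMat M m₃)) 0 1
      = M * P 0 1 * R 0 1 - m₁ * R 0 1 - m₃ * P 0 1 - Q 0 1 := by
  obtain ⟨h00, h01, h10, h11⟩ := mid_entries hQ
  rw [Matrix.trace_fin_two] at tP
  rw [mul_apply_zero_one, inv_eq_of_det_eq_one hP, h01]
  simp [lowerMat]
  linear_combination R 0 1 * tP

theorem leftChild_trace (hP : P.det = 1) (tP : P.trace = M * P 0 1 - m₁)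
    (tQ : Q.trace = M * Q 0 1 - m₂) (tR : R.trace = M * R 0 1 - m₃)
    (hQ : Q = P * R - lowerMat M m₂) :
    (P⁻¹ * (R + lowerMat M m₃)).trace = M * (P⁻¹ * (R + lowerMat M m₃)) 0 1 - m₂ := by
  rw [leftChild_zero_one hP tP hQ]
  obtain ⟨h00, h01, h10, h11⟩ := mid_entries hQ
  rw [Matrix.trace_fin_two] at tP tQ tR
  rw [trace_mul_two, inv_eq_of_det_eq_one hP]
  simp [lowerMat]
  linear_combination (R 0 0 + R 1 1 + m₃) * tP - tQ + (M * P 0 1 - m₁) * tR + h00 + h11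

theorem rightChild_zero_one (hR : R.det = 1) (tR : R.trace = M * R 0 1 - m₃)
    (hQ : Q = P * R - lowerMat M m₂) :
    ((P + lowerMat M m₁) * R⁻¹) 0 1
      = M * P 0 1 * R 0 1 - m₁ * R 0 1 - m₃ * P 0 1 - Q 0 1 := by
  obtain ⟨h00, h01, h10, h11⟩ := mid_entries hQ
  rw [Matrix.trace_fin_two] at tR
  rw [mul_apply_zero_one, inv_eq_of_det_eq_one hR, h01]
  simp [lowerMat]
  linear_combination P 0 1 * tR

theorem rightChild_trace (hR : R.det = 1) (tP : P.trace = M * P 0 1 - m₁)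
    (tQ : Q.trace = M * Q 0 1 - m₂) (tR : R.trace = M * R 0 1 - m₃)
    (hQ : Q = P * R - lowerMat M m₂) :
    ((P + lowerMat M m₁) * R⁻¹).trace = M * ((P + lowerMat M m₁) * R⁻¹) 0 1 - m₂ := by
  rw [rightChild_zero_one hR tR hQ]
  obtain ⟨h00, h01, h10, h11⟩ := mid_entries hQ
  rw [Matrix.trace_fin_two] at tP tQ tR
  rw [trace_mul_two, inv_eq_of_det_eq_one hR]
  simp [lowerMat]
  linear_combination (P 0 0 + P 1 1 + m₁) * tR - tQ + (M * R 0 1 - m₃) * tP + h00 + h11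

theorem isUnit_det_of_eq_one (hP : P.det = 1) : IsUnit P.det := by
  rw [hP]
  exact isUnit_one

/-- A triple with `Q = P R - m₂ (1 + M E₂₁)` is determined by its upper right entries, its traces
and the entry `P₁₁`. -/
theorem eq_of_mid_of_trace [IsDomain A] {P' Q' R' : Matrix (Fin 2) (Fin 2) A}
    (hP0 : P 0 1 ≠ 0) (hR0 : R 0 1 ≠ 0) (hP : P.det = 1) (hR : R.det = 1) (hP' : P'.det = 1)
    (hR' : R'.det = 1) (h00 : P 0 0 = P' 0 0) (eP : P 0 1 = P' 0 1) (eQ : Q 0 1 = Q' 0 1)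
    (eR : R 0 1 = R' 0 1) (tP : P.trace = P'.trace) (tR : R.trace = R'.trace)
    (hQ : Q = P * R - lowerMat M m₂) (hQ' : Q' = P' * R' - lowerMat M m₂) :
    P = P' ∧ Q = Q' ∧ R = R' := by
  rw [Matrix.det_fin_two] at hP hR hP' hR'
  rw [Matrix.trace_fin_two, Matrix.trace_fin_two] at tP tR
  have p11 : P 1 1 = P' 1 1 := by linear_combination tP - h00
  have p10 : P 1 0 = P' 1 0 := by
    refine mul_left_cancel₀ hP0 ?_
    rw [← eP, ← h00, ← p11] at hP'
    linear_combination hP' - hP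
  -- The entry `Q 0 1` is linear in `R 1 1` with coefficient `P 0 1 ≠ 0`.
  have r11 : R 1 1 = R' 1 1 := by
    refine mul_left_cancel₀ hP0 ?_
    have h1 := mid_zero_one hQ
    have h2 := mid_zero_one hQ'
    rw [← eP, ← h00, ← eQ, ← eR] at h2
    linear_combination h2 - h1
  have r00 : R 0 0 = R' 0 0 := by linear_combination tR - r11
  have r10 : R 1 0 = R' 1 0 := by
    refine mul_left_cancel₀ hR0 ?_
    rw [← eR, ← r00, ← r11] at hR'
    linear_combination hR' - hR
  have h1 : P = P' := by
    ext i j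
    fin_cases i <;> fin_cases j <;> assumption
  have h2 : R = R' := by
    ext i j
    fin_cases i <;> fin_cases j <;> assumption
  exact ⟨h1, by rw [hQ, hQ', h1, h2], h2⟩

end Entries

theorem S_eq (k : Fin 3 → ℕ) {P : Mat} {a m : Laurent} (ha : P 0 1 = a)
    (ht : P.trace = markovInv k * a - m) : S k P = lowerMat (markovInv k) m := by
  simp [S, ha, ht, lowerMat]

variable {k : Fin 3 → ℕ} {s : Fin 3 → Laurent} {τ : Equiv.Perm (Fin 3)} {T : Mat × Mat × Mat}

theorem IsVertex.S_fst (h : IsVertex k s τ T) :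
    S k T.1 = lowerMat (markovInv k) (k (τ 0) : Laurent) :=
  S_eq k h.fst h.trace_fst

theorem IsVertex.S_snd (h : IsVertex k s τ T) :
    S k T.2.1 = lowerMat (markovInv k) (k (τ 1) : Laurent) :=
  S_eq k h.snd h.trace_snd

theorem IsVertex.S_thd (h : IsVertex k s τ T) :
    S k T.2.2 = lowerMat (markovInv k) (k (τ 2) : Laurent) :=
  S_eq k h.thd h.trace_thd

theorem IsVertex.mid (h : IsVertex k s τ T) :
    T.2.1 = T.1 * T.2.2 - lowerMat (markovInv k) (k (τ 1) : Laurent) :=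
  h.S_snd ▸ h.mid_eq

theorem IsVertex.trace_fst' (h : IsVertex k s τ T) :
    T.1.trace = markovInv k * T.1 0 1 - (k (τ 0) : Laurent) := by rw [h.trace_fst, h.fst]

theorem IsVertex.trace_snd' (h : IsVertex k s τ T) :
    T.2.1.trace = markovInv k * T.2.1 0 1 - (k (τ 1) : Laurent) := by rw [h.trace_snd, h.snd]

theorem IsVertex.trace_thd' (h : IsVertex k s τ T) :
    T.2.2.trace = markovInv k * T.2.2 0 1 - (k (τ 2) : Laurent) := by rw [h.trace_thd, h.thd]

theorem mul_swap_one_two (τ : Equiv.Perm (Fin 3)) :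
    (τ * Equiv.swap 1 2 : Equiv.Perm (Fin 3)) 0 = τ 0 ∧
      (τ * Equiv.swap 1 2 : Equiv.Perm (Fin 3)) 1 = τ 2 ∧
      (τ * Equiv.swap 1 2 : Equiv.Perm (Fin 3)) 2 = τ 1 := by
  revert τ; decide

theorem mul_swap_zero_one (τ : Equiv.Perm (Fin 3)) :
    (τ * Equiv.swap 0 1 : Equiv.Perm (Fin 3)) 0 = τ 1 ∧
      (τ * Equiv.swap 0 1 : Equiv.Perm (Fin 3)) 1 = τ 0 ∧
      (τ * Equiv.swap 0 1 : Equiv.Perm (Fin 3)) 2 = τ 2 := by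
  revert τ; decide

/-- The last entry is replaced by its Vieta conjugate and moves to the middle, whence the
transposition of positions 1 and 2. -/
theorem IsVertex.leftParent (h : IsVertex k s τ T) :
    IsVertex k (vieta k (τ 2) s) (τ * Equiv.swap 1 2) (leftParent k T) := by
  obtain ⟨e0, e1, e2⟩ := mul_swap_one_two τ
  have v0 : vieta k (τ 2) s (τ 0) = s (τ 0) := vieta_of_ne k (by simp) s
  have v1 : vieta k (τ 2) s (τ 1) = s (τ 1) := vieta_of_ne k (by simp) s
  have v2 := vieta_perm k s τ (i := 2) (j := 0) (l := 1) (by decide) (by decide) (by decide)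
  have h01 := leftParent_zero_one h.det_fst h.trace_fst' h.mid
  have htr := leftParent_trace h.det_fst h.trace_fst' h.trace_snd' h.trace_thd' h.mid
  have hdet : (T.1 * T.2.1).det = 1 := by rw [Matrix.det_mul, h.det_fst, h.det_snd, one_mul]
  have hv : (T.1 * T.2.1) 0 1 = vieta k (τ 2) s (τ 2) := by
    rw [h01, v2, h.fst, h.snd, h.thd]
  have htr' : (T.1 * T.2.1 - S k T.2.2).trace
      = markovInv k * vieta k (τ 2) s (τ 2) - (k (τ 2) : Laurent) := by
    rw [h.S_thd, trace_sub_lowerMat, htr, hv]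
    ring
  have hv' : (T.1 * T.2.1 - S k T.2.2) 0 1 = vieta k (τ 2) s (τ 2) := by
    rw [h.S_thd, sub_lowerMat_zero_one, hv]
  constructor
  · exact h.det_fst
  · change (T.1 * T.2.1 - S k T.2.2).det = 1
    rw [h.S_thd]
    exact det_sub_lowerMat _ _ hdet htr
  · exact h.det_snd
  · rw [e0, v0]
    exact h.fst
  · rw [e1]
    exact hv'
  · rw [e2, v1]
    exact h.snd
  · rw [e0, v0]
    exact h.trace_fst
  · rw [e1]
    exact htr'
  · rw [e2, v1]
    exact h.trace_snd
  · change T.1 * T.2.1 - S k T.2.2 = T.1 * T.2.1 - S k (T.1 * T.2.1 - S k T.2.2)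
    rw [S_eq k hv' htr', h.S_thd]

theorem IsVertex.rightParent (h : IsVertex k s τ T) :
    IsVertex k (vieta k (τ 0) s) (τ * Equiv.swap 0 1) (rightParent k T) := by
  obtain ⟨e0, e1, e2⟩ := mul_swap_zero_one τ
  have v1 : vieta k (τ 0) s (τ 1) = s (τ 1) := vieta_of_ne k (by simp) s
  have v2 : vieta k (τ 0) s (τ 2) = s (τ 2) := vieta_of_ne k (by simp) s
  have v0 := vieta_perm k s τ (i := 0) (j := 1) (l := 2) (by decide) (by decide) (by decide)
  have h01 := rightParent_zero_one h.det_thd h.trace_thd' h.mid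
  have htr := rightParent_trace h.det_thd h.trace_fst' h.trace_snd' h.trace_thd' h.mid
  have hdet : (T.2.1 * T.2.2).det = 1 := by rw [Matrix.det_mul, h.det_snd, h.det_thd, one_mul]
  have hv : (T.2.1 * T.2.2) 0 1 = vieta k (τ 0) s (τ 0) := by
    rw [h01, v0, h.fst, h.snd, h.thd]
  have htr' : (T.2.1 * T.2.2 - S k T.1).trace
      = markovInv k * vieta k (τ 0) s (τ 0) - (k (τ 0) : Laurent) := by
    rw [h.S_fst, trace_sub_lowerMat, htr, hv]
    ring
  have hv' : (T.2.1 * T.2.2 - S k T.1) 0 1 = vieta k (τ 0) s (τ 0) := by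
    rw [h.S_fst, sub_lowerMat_zero_one, hv]
  constructor
  · exact h.det_snd
  · change (T.2.1 * T.2.2 - S k T.1).det = 1
    rw [h.S_fst]
    exact det_sub_lowerMat _ _ hdet htr
  · exact h.det_thd
  · rw [e0, v1]
    exact h.snd
  · rw [e1]
    exact hv'
  · rw [e2, v2]
    exact h.thd
  · rw [e0, v1]
    exact h.trace_snd
  · rw [e1]
    exact htr'
  · rw [e2, v2]
    exact h.trace_thd
  · change T.2.1 * T.2.2 - S k T.1 = T.2.1 * T.2.2 - S k (T.2.1 * T.2.2 - S k T.1)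
    rw [S_eq k hv' htr', h.S_fst]

/-- Here it is the middle entry that is replaced, and it moves to the end. Recovering the parent
needs only that the new matrix has the right correction term `S`. -/
theorem IsVertex.leftChild (h : IsVertex k s τ T) :
    IsVertex k (vieta k (τ 1) s) (τ * Equiv.swap 1 2) (leftChild k T) ∧
      GenCohn.leftParent k (GenCohn.leftChild k T) = T := by
  obtain ⟨e0, e1, e2⟩ := mul_swap_one_two τ
  have v0 : vieta k (τ 1) s (τ 0) = s (τ 0) := vieta_of_ne k (by simp) s
  have v2 : vieta k (τ 1) s (τ 2) = s (τ 2) := vieta_of_ne k (by simp) s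
  have v1 := vieta_perm k s τ (i := 1) (j := 0) (l := 2) (by decide) (by decide) (by decide)
  have h01 := leftChild_zero_one (m₃ := (k (τ 2) : Laurent)) h.det_fst h.trace_fst' h.mid
  have htr := leftChild_trace h.det_fst h.trace_fst' h.trace_snd' h.trace_thd' h.mid
  have hv : (T.1⁻¹ * (T.2.2 + S k T.2.2)) 0 1 = vieta k (τ 1) s (τ 1) := by
    rw [h.S_thd, h01, v1, h.fst, h.snd, h.thd]
  have htr' : (T.1⁻¹ * (T.2.2 + S k T.2.2)).trace
      = markovInv k * vieta k (τ 1) s (τ 1) - (k (τ 1) : Laurent) := by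
    rw [← hv, h.S_thd, htr]
  have hmul : T.1 * (T.1⁻¹ * (T.2.2 + S k T.2.2)) = T.2.2 + S k T.2.2 :=
    Matrix.mul_nonsing_inv_cancel_left _ _ (isUnit_det_of_eq_one h.det_fst)
  refine ⟨?_, ?_⟩
  · constructor
    · exact h.det_fst
    · exact h.det_thd
    · change (T.1⁻¹ * (T.2.2 + S k T.2.2)).det = 1
      have := congrArg Matrix.det hmul
      rwa [Matrix.det_mul, h.det_fst, one_mul, h.S_thd,
        det_add_lowerMat _ _ h.det_thd h.trace_thd', ← h.S_thd] at this
    · rw [e0, v0]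
      exact h.fst
    · rw [e1, v2]
      exact h.thd
    · rw [e2]
      exact hv
    · rw [e0, v0]
      exact h.trace_fst
    · rw [e1, v2]
      exact h.trace_thd
    · rw [e2]
      exact htr'
    · change T.2.2 = T.1 * (T.1⁻¹ * (T.2.2 + S k T.2.2)) - S k T.2.2
      rw [hmul, add_sub_cancel_right]
  · refine Prod.ext rfl (Prod.ext ?_ rfl)
    change T.1 * T.2.2 - S k (T.1⁻¹ * (T.2.2 + S k T.2.2)) = T.2.1
    rw [S_eq k hv htr']
    exact h.mid.symm

theorem IsVertex.rightChild (h : IsVertex k s τ T) :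
    IsVertex k (vieta k (τ 1) s) (τ * Equiv.swap 0 1) (rightChild k T) ∧
      GenCohn.rightParent k (GenCohn.rightChild k T) = T := by
  obtain ⟨e0, e1, e2⟩ := mul_swap_zero_one τ
  have v0 : vieta k (τ 1) s (τ 0) = s (τ 0) := vieta_of_ne k (by simp) s
  have v2 : vieta k (τ 1) s (τ 2) = s (τ 2) := vieta_of_ne k (by simp) s
  have v1 := vieta_perm k s τ (i := 1) (j := 0) (l := 2) (by decide) (by decide) (by decide)
  have h01 := rightChild_zero_one (m₁ := (k (τ 0) : Laurent)) h.det_thd h.trace_thd' h.mid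
  have htr := rightChild_trace h.det_thd h.trace_fst' h.trace_snd' h.trace_thd' h.mid
  have hv : ((T.1 + S k T.1) * T.2.2⁻¹) 0 1 = vieta k (τ 1) s (τ 1) := by
    rw [h.S_fst, h01, v1, h.fst, h.snd, h.thd]
  have htr' : ((T.1 + S k T.1) * T.2.2⁻¹).trace
      = markovInv k * vieta k (τ 1) s (τ 1) - (k (τ 1) : Laurent) := by
    rw [← hv, h.S_fst, htr]
  have hmul : (T.1 + S k T.1) * T.2.2⁻¹ * T.2.2 = T.1 + S k T.1 :=
    Matrix.nonsing_inv_mul_cancel_right _ _ (isUnit_det_of_eq_one h.det_thd)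
  refine ⟨?_, ?_⟩
  · constructor
    · change ((T.1 + S k T.1) * T.2.2⁻¹).det = 1
      have := congrArg Matrix.det hmul
      rwa [Matrix.det_mul, h.det_thd, mul_one, h.S_fst,
        det_add_lowerMat _ _ h.det_fst h.trace_fst', ← h.S_fst] at this
    · exact h.det_fst
    · exact h.det_thd
    · rw [e0]
      exact hv
    · rw [e1, v0]
      exact h.fst
    · rw [e2, v2]
      exact h.thd
    · rw [e0]
      exact htr'
    · rw [e1, v0]
      exact h.trace_fst
    · rw [e2, v2]
      exact h.trace_thd
    · change T.1 = (T.1 + S k T.1) * T.2.2⁻¹ * T.2.2 - S k T.1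
      rw [hmul, add_sub_cancel_right]
  · refine Prod.ext rfl (Prod.ext ?_ rfl)
    change T.1 * T.2.2 - S k ((T.1 + S k T.1) * T.2.2⁻¹) = T.2.1
    rw [S_eq k hv htr']
    exact h.mid.symm

theorem IsVertex.leftChild_leftParent (h : IsVertex k s τ T) :
    GenCohn.leftChild k (GenCohn.leftParent k T) = T := by
  refine Prod.ext rfl (Prod.ext rfl ?_)
  change T.1⁻¹ * (T.2.1 + S k T.2.1) = T.2.2
  rw [eq_sub_iff_add_eq.1 h.mid_eq,
    Matrix.nonsing_inv_mul_cancel_left _ _ (isUnit_det_of_eq_one h.det_fst)]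

theorem IsVertex.rightChild_rightParent (h : IsVertex k s τ T) :
    GenCohn.rightChild k (GenCohn.rightParent k T) = T := by
  refine Prod.ext ?_ (Prod.ext rfl rfl)
  change (T.2.1 + S k T.2.1) * T.2.2⁻¹ = T.1
  rw [eq_sub_iff_add_eq.1 h.mid_eq,
    Matrix.mul_nonsing_inv_cancel_right _ _ (isUnit_det_of_eq_one h.det_thd)]

theorem algebraMap_xinv (i : Fin 3) :
    algebraMap Laurent RatFun (xinv i) = (algebraMap Laurent RatFun (x i))⁻¹ := by
  refine eq_inv_of_mul_eq_one_right ?_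
  rw [← map_mul, x_mul_xinv, map_one]

theorem markovInv_perm (k : Fin 3 → ℕ) (σ : Equiv.Perm (Fin 3)) :
    markovInv k = (x (σ 0) ^ 2 + x (σ 1) ^ 2 + x (σ 2) ^ 2 + (k (σ 0) : Laurent) * x (σ 1) * x (σ 2)
      + (k (σ 1) : Laurent) * x (σ 0) * x (σ 2) + (k (σ 2) : Laurent) * x (σ 0) * x (σ 1))
      * (xinv (σ 0) * xinv (σ 1) * xinv (σ 2)) := by
  have h : ∀ σ : Equiv.Perm (Fin 3),
      σ 0 = 0 ∧ σ 1 = 1 ∧ σ 2 = 2 ∨ σ 0 = 0 ∧ σ 1 = 2 ∧ σ 2 = 1 ∨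
      σ 0 = 1 ∧ σ 1 = 0 ∧ σ 2 = 2 ∨ σ 0 = 1 ∧ σ 1 = 2 ∧ σ 2 = 0 ∨
      σ 0 = 2 ∧ σ 1 = 0 ∧ σ 2 = 1 ∨ σ 0 = 2 ∧ σ 1 = 1 ∧ σ 2 = 0 := by decide
  rw [markovInv]
  rcases h σ with ⟨h0, h1, h2⟩ | ⟨h0, h1, h2⟩ | ⟨h0, h1, h2⟩ | ⟨h0, h1, h2⟩ | ⟨h0, h1, h2⟩ |
    ⟨h0, h1, h2⟩ <;> rw [h0, h1, h2] <;> ring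

theorem isVertex_root (k : Fin 3 → ℕ) (σ : Equiv.Perm (Fin 3)) (f : Laurent) :
    IsVertex k x σ (rootP k σ f, rootQ k σ f, rootR k σ f) := by
  have hne : ∀ i, algebraMap Laurent RatFun (x i) ≠ 0 := fun i => by
    simpa using (isMarkov_x k).ne_zero i
  have n0 := hne (σ 0)
  have n1 := hne (σ 1)
  have n2 := hne (σ 2)
  have tP : (rootP k σ f).trace = markovInv k * x (σ 0) - (k (σ 0) : Laurent) := by
    -- The identity is checked in the fraction field, where denominators can be cleared.
    rw [markovInv_perm k σ, ← algebraMap_inj]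
    simp [rootP, unimodular, Matrix.trace_fin_two, algebraMap_xinv]
    field_simp
    ring
  have tQ : (rootQ k σ f).trace = markovInv k * x (σ 1) - (k (σ 1) : Laurent) := by
    rw [markovInv_perm k σ, ← algebraMap_inj]
    simp [rootQ, unimodular, Matrix.trace_fin_two, algebraMap_xinv]
    field_simp
    ring
  have tR : (rootR k σ f).trace = markovInv k * x (σ 2) - (k (σ 2) : Laurent) := by
    rw [markovInv_perm k σ, ← algebraMap_inj]
    simp [rootR, unimodular, Matrix.trace_fin_two, algebraMap_xinv]
    field_simp
    ring
  refine ⟨det_unimodular _ _ _, det_unimodular _ _ _, det_unimodular _ _ _, rfl, rfl, rfl, tP, tQ,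
    tR, ?_⟩
  change rootQ k σ f = rootP k σ f * rootR k σ f - S k (rootQ k σ f)
  rw [S_eq k (a := x (σ 1)) rfl tQ, markovInv_perm k σ]
  refine Matrix.ext fun i j => ?_
  rw [← algebraMap_inj]
  fin_cases i <;> fin_cases j
  · simp [lowerMat, rootP, rootQ, rootR, unimodular, algebraMap_xinv]
    field_simp
    ring
  · simp [lowerMat, rootP, rootQ, rootR, unimodular, algebraMap_xinv]
    field_simp
    ring
  · simp [lowerMat, rootP, rootQ, rootR, unimodular, algebraMap_xinv]
    field_simp
    ring
  · simp [lowerMat, rootP, rootQ, rootR, unimodular, algebraMap_xinv]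
    field_simp
    ring

theorem IsVertex.eq_root (h : IsVertex k x τ T) :
    (rootP k τ (T.1 0 0), rootQ k τ (T.1 0 0), rootR k τ (T.1 0 0)) = T := by
  have h' := isVertex_root k τ (T.1 0 0)
  have hx := (isMarkov_x k).ne_zero
  obtain ⟨h1, h2, h3⟩ := eq_of_mid_of_trace (h'.fst ▸ hx _) (h'.thd ▸ hx _) h'.det_fst h'.det_thd
    h.det_fst h.det_thd rfl (h'.fst.trans h.fst.symm) (h'.snd.trans h.snd.symm)
    (h'.thd.trans h.thd.symm) (h'.trace_fst.trans h.trace_fst.symm)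
    (h'.trace_thd.trans h.trace_thd.symm) h'.mid h.mid
  exact Prod.ext h1 (Prod.ext h2 h3)

/-! ### Ascending clusters -/

/-- The triples reached from the initial cluster by Vieta moves that replace an entry which does
not exceed the maximum of the two others. -/
inductive Ascending (k : Fin 3 → ℕ) : (Fin 3 → Laurent) → Prop
  | init : Ascending k x
  | step (s : Fin 3 → Laurent) (i : Fin 3) (hs : Ascending k s)
      (hi : evalOne (s i) ≤ max (evalOne (s (i + 1))) (evalOne (s (i + 2)))) :
      Ascending k (vieta k i s)

theorem Ascending.isMarkov (h : Ascending k s) : IsMarkov k s := by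
  induction h with
  | init => exact isMarkov_x k
  | step s i _ _ ih => exact ih.vieta i

theorem IsMarkov.lt_vieta (h : IsMarkov k s) {i j : Fin 3}
    (hi : evalOne (s i) ≤ max (evalOne (s (i + 1))) (evalOne (s (i + 2)))) (hj : j ≠ i) :
    evalOne (s j) < evalOne (GenCohn.vieta k i s i) := by
  refine lt_of_le_of_lt ?_ (h.max_lt_vieta hi)
  rcases eq_or_eq_add_one_or_eq_add_two i j with rfl | rfl | rfl
  · exact absurd rfl hj
  · exact le_max_left _ _
  · exact le_max_right _ _

/-- A move that is not ascending acts at the strict maximum. This excludes the initial cluster,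
whose values are all 1, and otherwise forces the position of the last ascending move, which is then
undone. -/
theorem Ascending.vieta (h : Ascending k s) (i : Fin 3) : Ascending k (vieta k i s) := by
  by_cases hi : evalOne (s i) ≤ max (evalOne (s (i + 1))) (evalOne (s (i + 2)))
  · exact h.step s i hi
  · cases h with
    | init => simp [evalOne_x] at hi
    | step s j hs hj =>
      by_cases hij : i = j
      · rw [hij, vieta_vieta]
        exact hs
      · refine absurd ?_ hi
        have hlt := hs.isMarkov.lt_vieta hj hij
        rw [← vieta_of_ne k hij s] at hlt
        rcases eq_or_eq_add_one_or_eq_add_two i j with rfl | rfl | rfl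
        · exact absurd rfl hij
        · exact le_max_of_le_left hlt.le
        · exact le_max_of_le_right hlt.le

theorem ascending_vietas (k : Fin 3 → ℕ) (w : List (Fin 3)) : Ascending k (vietas k w) := by
  induction w using List.reverseRecOn with
  | nil => exact Ascending.init
  | append_singleton w i ih => rw [vietas_concat]; exact ih.vieta i

theorem eq_perm_zero_or_one_or_two (τ : Equiv.Perm (Fin 3)) (i : Fin 3) :
    i = τ 0 ∨ i = τ 1 ∨ i = τ 2 := by
  revert τ i; decide

theorem le_max_perm {α : Type*} [LinearOrder α] (u : Fin 3 → α) (τ : Equiv.Perm (Fin 3)) :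
    u (τ 1) ≤ max (u (τ 1 + 1)) (u (τ 1 + 2)) ↔ u (τ 1) ≤ max (u (τ 0)) (u (τ 2)) := by
  rcases perm_three_cases τ 1 0 2 (by decide) (by decide) (by decide) with ⟨h0, h2⟩ | ⟨h0, h2⟩
  · rw [h0, h2]
  · rw [h0, h2, max_comm]

/-! ### Existence -/

theorem exists_invTree_eq (h : Ascending k s) {τ : Equiv.Perm (Fin 3)} {T : Mat × Mat × Mat}
    (hT : IsVertex k s τ T)
    (hle : evalOne (s (τ 1)) ≤ max (evalOne (s (τ 0))) (evalOne (s (τ 2)))) :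
    ∃ (f : Laurent) (σ : Equiv.Perm (Fin 3)) (v : List Bool), invTree k σ f v = T := by
  induction h generalizing τ T with
  | init => exact ⟨T.1 0 0, τ, [], hT.eq_root⟩
  | step s i hs hi ih =>
    have hlt : ∀ j, j ≠ i → evalOne (s j) < evalOne (vieta k i s i) :=
      fun j hj => hs.isMarkov.lt_vieta hi hj
    have hcases : i = τ 0 ∨ i = τ 1 ∨ i = τ 2 := eq_perm_zero_or_one_or_two τ i
    rcases hcases with rfl | rfl | rfl
    · have hT' := hT.rightParent
      rw [vieta_vieta] at hT'
      obtain ⟨e0, e1, e2⟩ := mul_swap_zero_one τ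
      -- The restored entry is now in the middle, and `hi` says precisely that it does not exceed
      -- both of its neighbours.
      obtain ⟨f, σ, v, hv⟩ := ih hT' (by
        rw [← le_max_perm (fun j => evalOne (s j)), e1]
        exact hi)
      exact ⟨f, σ, true :: v, by rw [invTree, hv, hT.rightChild_rightParent]⟩
    · have h0 := hlt (τ 0) (by simp)
      have h2 := hlt (τ 2) (by simp)
      rw [← vieta_of_ne k (i := τ 1) (j := τ 0) (by simp) s] at h0
      rw [← vieta_of_ne k (i := τ 1) (j := τ 2) (by simp) s] at h2
      -- The last move would have made the middle entry the strict maximum.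
      exact absurd hle (not_le.2 (max_lt h0 h2))
    · have hT' := hT.leftParent
      rw [vieta_vieta] at hT'
      obtain ⟨e0, e1, e2⟩ := mul_swap_one_two τ
      obtain ⟨f, σ, v, hv⟩ := ih hT' (by
        rw [← le_max_perm (fun j => evalOne (s j)), e1]
        exact hi)
      exact ⟨f, σ, false :: v, by rw [invTree, hv, hT.leftChild_leftParent]⟩

/-! ### Uniqueness -/

/-- The middle entry is never the strict maximum, so each step down the tree is an ascending move
whose new maximum lands in an outer place. This keeps the condition on the middle entry valid. -/
theorem exists_isVertex_invTree (k : Fin 3 → ℕ) (σ : Equiv.Perm (Fin 3)) (f : Laurent)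
    (v : List Bool) : ∃ (s : Fin 3 → Laurent) (τ : Equiv.Perm (Fin 3)), IsMarkov k s ∧
      IsVertex k s τ (invTree k σ f v) ∧
      evalOne (s (τ 1)) ≤ max (evalOne (s (τ 0))) (evalOne (s (τ 2))) := by
  induction v with
  | nil => exact ⟨x, σ, isMarkov_x k, isVertex_root k σ f, by simp [evalOne_x]⟩
  | cons b v ih =>
    obtain ⟨s, τ, hs, hT, hle⟩ := ih
    have hlt : ∀ j, j ≠ τ 1 → evalOne (s j) < evalOne (vieta k (τ 1) s (τ 1)) := fun j hj =>
      hs.lt_vieta ((le_max_perm (fun j => evalOne (s j)) τ).2 hle) hj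
    cases b
    · obtain ⟨e0, e1, e2⟩ := mul_swap_one_two τ
      refine ⟨_, _, hs.vieta (τ 1), hT.leftChild.1, le_max_of_le_right ?_⟩
      rw [e1, e2, vieta_of_ne k (by simp)]
      exact (hlt _ (by simp)).le
    · obtain ⟨e0, e1, e2⟩ := mul_swap_zero_one τ
      refine ⟨_, _, hs.vieta (τ 1), hT.rightChild.1, le_max_of_le_left ?_⟩
      rw [e1, e0, vieta_of_ne k (by simp)]
      exact (hlt _ (by simp)).le

theorem invTree_left_lt (k : Fin 3 → ℕ) (σ : Equiv.Perm (Fin 3)) (f : Laurent) (v : List Bool) :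
    evalOne ((invTree k σ f (false :: v)).1 0 1)
      < evalOne ((invTree k σ f (false :: v)).2.2 0 1) := by
  obtain ⟨s, τ, hs, hT, hle⟩ := exists_isVertex_invTree k σ f v
  have hC := hT.leftChild.1
  obtain ⟨e0, e1, e2⟩ := mul_swap_one_two τ
  rw [invTree, hC.fst, hC.thd, e0, e2, vieta_of_ne k (by simp)]
  exact hs.lt_vieta ((le_max_perm (fun j => evalOne (s j)) τ).2 hle) (by simp)

theorem invTree_right_lt (k : Fin 3 → ℕ) (σ : Equiv.Perm (Fin 3)) (f : Laurent) (v : List Bool) :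
    evalOne ((invTree k σ f (true :: v)).2.2 0 1)
      < evalOne ((invTree k σ f (true :: v)).1 0 1) := by
  obtain ⟨s, τ, hs, hT, hle⟩ := exists_isVertex_invTree k σ f v
  have hC := hT.rightChild.1
  obtain ⟨e0, e1, e2⟩ := mul_swap_zero_one τ
  rw [invTree, hC.fst, hC.thd, e0, e2, vieta_of_ne k (j := τ 2) (by simp)]
  exact hs.lt_vieta ((le_max_perm (fun j => evalOne (s j)) τ).2 hle) (by simp)

theorem invTree_nil_eq (k : Fin 3 → ℕ) (σ : Equiv.Perm (Fin 3)) (f : Laurent) :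
    evalOne ((invTree k σ f []).1 0 1) = evalOne ((invTree k σ f []).2.2 0 1) := by
  simp [invTree, rootP, rootR, unimodular, evalOne_x]

theorem x_injective : Function.Injective x := fun _ _ h =>
  -- The variables form the cluster of the empty word, so any parameters would do.
  position_unique 0 (w := []) (w' := []) h

theorem perm_three_ext {σ σ' : Equiv.Perm (Fin 3)} (h0 : σ 0 = σ' 0) (h1 : σ 1 = σ' 1) :
    σ = σ' := by
  revert σ σ'; decide

/-- The order of the outer values tells root, left child and right child apart, and `leftParent` or
`rightParent` removes the turn from both sides. -/
theorem invTree_injective {σ σ' : Equiv.Perm (Fin 3)} {f f' : Laurent} {v v' : List Bool}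
    (h : invTree k σ f v = invTree k σ' f' v') : f = f' ∧ σ = σ' ∧ v = v' := by
  induction v generalizing v' with
  | nil =>
    have hn := invTree_nil_eq k σ f
    rw [h] at hn
    match v' with
    | [] =>
      have h0 : f = f' := by
        simpa [invTree, rootP, unimodular] using congrArg (fun T => T.1 0 0) h
      have h1 : σ 0 = σ' 0 := x_injective <| by
        simpa [invTree, rootP, unimodular] using congrArg (fun T => T.1 0 1) h
      have h2 : σ 1 = σ' 1 := x_injective <| by
        simpa [invTree, rootQ, unimodular] using congrArg (fun T => T.2.1 0 1) h
      refine ⟨h0, ?_, rfl⟩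
      exact perm_three_ext h1 h2
    | false :: v' => exact absurd hn (invTree_left_lt k σ' f' v').ne
    | true :: v' => exact absurd hn (invTree_right_lt k σ' f' v').ne'
  | cons b v ih =>
    obtain ⟨s, τ, -, hT, -⟩ := exists_isVertex_invTree k σ f v
    cases b
    · have hlt := invTree_left_lt k σ f v
      rw [h] at hlt
      match v' with
      | [] => exact absurd (invTree_nil_eq k σ' f') hlt.ne
      | false :: v' =>
        obtain ⟨s', τ', -, hT', -⟩ := exists_isVertex_invTree k σ' f' v'
        have := congrArg (leftParent k) h
        rw [invTree, invTree, hT.leftChild.2, hT'.leftChild.2] at this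
        obtain ⟨h1, h2, h3⟩ := ih this
        exact ⟨h1, h2, by rw [h3]⟩
      | true :: v' => exact absurd hlt (invTree_right_lt k σ' f' v').not_gt
    · have hlt := invTree_right_lt k σ f v
      rw [h] at hlt
      match v' with
      | [] => exact absurd (invTree_nil_eq k σ' f') hlt.ne'
      | false :: v' => exact absurd hlt (invTree_left_lt k σ' f' v').not_gt
      | true :: v' =>
        obtain ⟨s', τ', -, hT', -⟩ := exists_isVertex_invTree k σ' f' v'
        have := congrArg (rightParent k) h
        rw [invTree, invTree, hT.rightChild.2, hT'.rightChild.2] at this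
        obtain ⟨h1, h2, h3⟩ := ih this
        exact ⟨h1, h2, by rw [h3]⟩

/-! ### Cluster generalized Cohn triples are vertices -/

/-- The parity in the definition may come from another labeled cluster `w'`; uniqueness of the
position identifies it with `k i`. -/
theorem IsCGCMatrix.trace_eq {P : Mat} (h : IsCGCMatrix k P) {w : List (Fin 3)} {i : Fin 3}
    (hi : P 0 1 = vietas k w i) : P.trace = markovInv k * vietas k w i - (k i : Laurent) := by
  obtain ⟨-, -, m, ⟨w', j, hj, rfl⟩, ht⟩ := h
  rw [cluster_eq, algebraMap_inj, hi] at hj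
  rw [ht, hi, position_unique k hj]

theorem IsCGCTriple.exists_isVertex {P Q R : Mat} (h : IsCGCTriple k P Q R) :
    ∃ (w : List (Fin 3)) (τ : Equiv.Perm (Fin 3)), IsVertex k (vietas k w) τ (P, Q, R) := by
  obtain ⟨w, τ, h0, h1, h2⟩ := h.isNonLabeledCluster
  rw [cluster_eq, algebraMap_inj] at h0 h1 h2
  exact ⟨w, τ, h.isCGCMatrix_fst.1, h.isCGCMatrix_snd.1, h.isCGCMatrix_thd.1, h0, h1, h2,
    h.isCGCMatrix_fst.trace_eq h0, h.isCGCMatrix_snd.trace_eq h1, h.isCGCMatrix_thd.trace_eq h2,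
    h.mid_eq⟩

end

end GenCohn

theorem mainTheorem5 (k : Fin 3 → ℕ) (a b c : GenCohn.Laurent) (P Q R : GenCohn.Mat)
    (hPQR : GenCohn.IsCGCTripleAssoc k a b c P Q R)
    (hb : GenCohn.evalOne b ≤ max (GenCohn.evalOne a) (GenCohn.evalOne c)) :
    ∃! t : GenCohn.Laurent × Equiv.Perm (Fin 3) × List Bool,
      GenCohn.invTree k t.2.1 t.1 t.2.2 = (P, Q, R) := by
  obtain ⟨h, rfl, rfl, rfl⟩ := hPQR
  obtain ⟨w, τ, hT⟩ := h.exists_isVertex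
  obtain ⟨f, σ, v, hv⟩ := GenCohn.exists_invTree_eq (GenCohn.ascending_vietas k w) hT
    (by rw [← hT.fst, ← hT.snd, ← hT.thd]; exact hb)
  refine ⟨(f, σ, v), hv, ?_⟩
  rintro ⟨f', σ', v'⟩ h'
  obtain ⟨h1, h2, h3⟩ := GenCohn.invTree_injective (h'.trans hv.symm)
  exact Prod.ext h1 (Prod.ext h2 h3)
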